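/- Let $\Omega\subset\mathbb{R}^d$ be a bounded open set and let $c:\mathbb{R}^d\to\mathbb{R}$ be measurable with $0<c_{\min}\le c\le c_{\max}$ on $\Omega$. Let $\mathcal A=-c\,\Delta[c\,\cdot]$ with homogeneous Dirichlet boundary conditions, understood in the weak sense in $L^2(\Omega)$: $\mathcal A u=v$ means that $cu\in H^1_0(\Omega)$ and $\int_\Omega\nabla(cu)\cdot\nabla(c\psi)\,dx=\int_\Omega v\psi\,dx$ for all $\psi\in L^2(\Omega)$ with $c\psi\in H^1_0(\Omega)$. Its spectrum is discrete, and $\Phi(\mathcal A)$ denotes the operator with the eigenfunctions of $\mathcal A$ and the eigenvalues $\Phi(\theta)$, where $\theta$ runs through the eigenvalues of $\mathcal A$. Let $x_1,\dots,x_m\in\Omega$ be points near which $c$ is equal to a constant $\bar c$, let $f:\mathbb{R}\to\mathbb{R}$ be an integrable signal with Fourier transform $\hat f(\omega)=\int f(t)e^{i\omega t}\,dt$, and let $\tau>0$, $n\ge1$. Put $$u_0^{(s)}=\big|\hat f(\sqrt{\mathcal A})\big|\,\delta_{x_s}=\sum_k \big|\hat f(\sqrt{\theta_k})\big|\,y_k(x_s)\,y_k,\qquad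 u^{(s)}(t)=\cos(t\sqrt{\mathcal A})\,u_0^{(s)},\qquad s=1,\dots,m,$$ where $(y_k)$ is an orthonormal basis of eigenfunctions of $\mathcal A$ with eigenvalues $\theta_k$ (the series being convergent in $L^2(\Omega)$). Define the propagator $\mathcal P=\cos(\tau\sqrt{\mathcal A})$, the row vectors of snapshots ${\bf u}_j=(u^{(1)}(j\tau),\dots,u^{(m)}(j\tau))$, the row vector ${\bf U}=({\bf u}_0,\dots,{\bf u}_{n-1})$ with $nm$ components, the $m\times m$ data matrices ${\bf D}_j=\int_\Omega {\bf u}_0^T{\bf u}_j\,dx$ for $j\ge0$, and the $nm\times nm$ mass and stiffness matrices $${\bf M}=\int_\Omega {\bf U}^T{\bf U}\,dx,\qquad {\bf S}=\int_\Omega {\bf U}^T\mathcal P{\bf U}\,dx,$$ with $m\times m$ blocks ${\bf M}_{i,j}=\int_\Omega{\bf u}_i^T{\bf u}_j\,dx$ and ${\bf S}_{i,j}=\int_\Omega{\bf u}_i^T\mathcal P{\bf u}_j\,dx$, $0\le i,j\le n-1$. Assume that the span $\mathscr U$ of the components of ${\bf U}$ has dimension $nm$. The Galerkin approximation ${\bf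 u}_j^{\rm Gal}={\bf U}{\bf g}_j$, $j\ge0$, of the time stepping ${\bf u}_{j+1}=2\mathcal P{\bf u}_j-{\bf u}_{|j-1|}$ has coefficients ${\bf g}_j\in\mathbb{R}^{nm\times m}$ defined by ${\bf U}{\bf g}_0={\bf u}_0$ and by the requirement that, for every $j\ge0$, the components of ${\bf U}{\bf g}_{j+1}+{\bf U}{\bf g}_{|j-1|}-2\mathcal P{\bf U}{\bf g}_j$ are orthogonal to $\mathscr U$. A block Gram–Schmidt orthogonalization of ${\bf U}$ is a factorization ${\bf U}={\bf V}{\bf R}$ in which ${\bf V}=({\bf v}_0,\dots,{\bf v}_{n-1})$ has $nm$ orthonormal components, those of ${\bf v}_j$ lie in the span of the components of ${\bf u}_0,\dots,{\bf u}_j$, and ${\bf R}\in\mathbb{R}^{nm\times nm}$ is invertible and block upper triangular with $m\times m$ blocks. Then: 1. The Galerkin coefficients exist and are unique, and ${\bf g}_j={\bf e}_j$ for $j=0,\dots,n-1$, where ${\bf I}_{nm}=({\bf e}_0,\dots,{\bf e}_{n-1})$ is the identity matrix split in $nm\times m$ block columns. 2. For $i,j=0,\dots,n-1$, $${\bf M}_{i,j}=\tfrac12\big({\bf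 D}_{i+j}+{\bf D}_{|i-j|}\big),\qquad {\bf S}_{i,j}=\tfrac14\big({\bf D}_{i+j+1}+{\bf D}_{|i-j+1|}+{\bf D}_{|i+j-1|}+{\bf D}_{|i-j-1|}\big).$$ 3. Block Gram–Schmidt orthogonalizations ${\bf U}={\bf V}{\bf R}$ exist, and for each of them ${\bf R}^T{\bf R}={\bf M}$. Moreover, a matrix ${\bf R}$ is the factor of such an orthogonalization if and only if it is a block Cholesky factor of ${\bf M}$, that is, ${\bf R}$ is block upper triangular and ${\bf R}^T{\bf R}={\bf M}$. Hence ${\bf R}$ is data driven: the set of possible factors ${\bf R}$ is determined by the data matrices, through ${\bf M}$. -/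

import Mathlib

open MeasureTheory Filter Topology
open scoped Matrix ContDiff

noncomputable section

namespace WaveROM

/-! ### The symmetrized wave operator `A = - c Δ [c ·]` with Dirichlet boundary conditions -/

/-- The Euclidean space `ℝ^d`. -/
abbrev Space (d : ℕ) : Type := EuclideanSpace ℝ (Fin d)

/-- The Hilbert space `L²(Ω)` of real valued functions. -/
abbrev L2 {d : ℕ} (Ω : Set (Space d)) := Lp ℝ 2 (volume.restrict Ω)

/-- The Hilbert space `L²(Ω; ℝ^d)` of vector fields. -/
abbrev L2Vec {d : ℕ} (Ω : Set (Space d)) := Lp (Space d) 2 (volume.restrict Ω)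

/-- The Sobolev space `H¹₀(Ω)`, as the set of pairs `(w, ∇w)`: the closure in
`L²(Ω) × L²(Ω; ℝ^d)` of the pairs `(φ, ∇φ)` with `φ` smooth and compactly supported in `Ω`. -/
def H10 {d : ℕ} (Ω : Set (Space d)) : Submodule ℝ (L2 Ω × L2Vec Ω) :=
  (Submodule.span ℝ {p : L2 Ω × L2Vec Ω | ∃ φ : Space d → ℝ,
    ContDiff ℝ ∞ φ ∧ HasCompactSupport φ ∧ tsupport φ ⊆ Ω ∧
    p.1 =ᵐ[volume.restrict Ω] φ ∧ p.2 =ᵐ[volume.restrict Ω] gradient φ}).topologicalClosure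

/-- The pairs `(u, ∇(c u))` with `u ∈ L²(Ω)` and `c u ∈ H¹₀(Ω)`. -/
def formGraph {d : ℕ} (Ω : Set (Space d)) (c : Space d → ℝ) : Set (L2 Ω × L2Vec Ω) :=
  {p | ∃ w : L2 Ω, (w =ᵐ[volume.restrict Ω] fun x => c x * p.1 x) ∧ (w, p.2) ∈ H10 Ω}

/-- The graph of the operator `A = - c Δ [c ·]` with homogeneous Dirichlet boundary conditions:
`u` is in the domain and `A u = v` when `c u ∈ H¹₀(Ω)` and
`∫ ∇(c u) · ∇(c ψ) = ∫ v ψ` for all `ψ` with `c ψ ∈ H¹₀(Ω)`. -/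
def waveOpGraph {d : ℕ} (Ω : Set (Space d)) (c : Space d → ℝ) : Set (L2 Ω × L2 Ω) :=
  {p | ∃ G : L2Vec Ω, (p.1, G) ∈ formGraph Ω c ∧
    ∀ q ∈ formGraph Ω c,
      ∫ x in Ω, inner ℝ (G x) (q.2 x) = ∫ x in Ω, p.2 x * q.1 x}

/-- The eigenspace of `A` at `θ`, `{u | A u = θ u}` (which is a closed subspace). -/
def eigenspace {d : ℕ} (Ω : Set (Space d)) (c : Space d → ℝ) (θ : ℝ) : Submodule ℝ (L2 Ω) :=
  (Submodule.span ℝ {u : L2 Ω | (u, θ • u) ∈ waveOpGraph Ω c}).topologicalClosure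

instance eigenspaceProj {d : ℕ} (Ω : Set (Space d)) (c : Space d → ℝ) (θ : ℝ) :
    (eigenspace Ω c θ).HasOrthogonalProjection := by
  have : CompleteSpace (eigenspace Ω c θ) :=
    (Submodule.isClosed_topologicalClosure _).completeSpace_coe
  exact Submodule.HasOrthogonalProjection.ofCompleteSpace _

/-! ### Functional calculus: the spectrum of `A` is discrete -/

/-- `Φ(A) u`: the operator `Φ(A)` acts as multiplication by `Φ θ` on the eigenspace of `A` at `θ`,
`Φ(A) u = ∑_θ Φ(θ) E_θ u`, where `E_θ` is the orthogonal projection on this eigenspace. -/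
def funcCalc {d : ℕ} (Ω : Set (Space d)) (c : Space d → ℝ) (Φ : ℝ → ℝ) (u : L2 Ω) : L2 Ω :=
  ∑' θ : ℝ, Φ θ • (eigenspace Ω c θ).starProjection u

/-- The function `k` in the eigenspace of `A` at `θ` represents the evaluation at `x` on this
eigenspace, `⟨k, y⟩ = y(x)`. So `k = ∑ y_j(x) y_j` for an orthonormal basis `y_j` of the
eigenspace. The value at `x` of a class `y` is the limit of its averages over small balls. -/
def IsSpectralKernel {d : ℕ} (Ω : Set (Space d)) (c : Space d → ℝ) (θ : ℝ) (x : Space d)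
    (k : L2 Ω) : Prop :=
  k ∈ eigenspace Ω c θ ∧ ∀ y ∈ eigenspace Ω c θ,
    Tendsto (fun r : ℝ => ⨍ z in Metric.ball x r, y z) (𝓝[>] 0) (𝓝 (∫ z in Ω, k z * y z))

open Classical in
/-- The component `E_θ δ_x` of the Dirac delta at `x` in the eigenspace of `A` at `θ`. -/
def spectralKernel {d : ℕ} (Ω : Set (Space d)) (c : Space d → ℝ) (θ : ℝ) (x : Space d) : L2 Ω :=
  if h : ∃ k, IsSpectralKernel Ω c θ x k then h.choose else 0

/-- `Φ(A) δ_x = ∑_θ Φ(θ) E_θ δ_x = ∑_j Φ(θ_j) y_j(x) y_j`, for an orthonormal basis of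
eigenfunctions `y_j`, with eigenvalues `θ_j`. -/
def funcCalcDelta {d : ℕ} (Ω : Set (Space d)) (c : Space d → ℝ) (Φ : ℝ → ℝ) (x : Space d) : L2 Ω :=
  ∑' θ : ℝ, Φ θ • spectralKernel Ω c θ x

/-! ### Waves, snapshots, data -/

/-- The Fourier transform `∫ f(t) e^{i w t} dt`. -/
def signalFT (f : ℝ → ℝ) (w : ℝ) : ℂ := ∫ t : ℝ, (f t : ℂ) * Complex.exp (Complex.I * w * t)

/-- The initial states `u₀^{(s)} = |f̂(√A)| δ_{x_s}`. -/
def initialState {d m : ℕ} (Ω : Set (Space d)) (c : Space d → ℝ) (f : ℝ → ℝ)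
    (xs : Fin m → Space d) (s : Fin m) : L2 Ω :=
  funcCalcDelta Ω c (fun θ => ‖signalFT f (Real.sqrt θ)‖) (xs s)

/-- The waves `u^{(s)}(t) = cos(t √A) u₀^{(s)}`. -/
def wave {d m : ℕ} (Ω : Set (Space d)) (c : Space d → ℝ) (f : ℝ → ℝ)
    (xs : Fin m → Space d) (t : ℝ) (s : Fin m) : L2 Ω :=
  funcCalc Ω c (fun θ => Real.cos (t * Real.sqrt θ)) (initialState Ω c f xs s)

/-- The propagator `P = cos(τ √A)`. -/
def propagator {d : ℕ} (Ω : Set (Space d)) (c : Space d → ℝ) (τ : ℝ) (u : L2 Ω) : L2 Ω :=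
  funcCalc Ω c (fun θ => Real.cos (τ * Real.sqrt θ)) u

/-- The `m × m` data matrices `D_j = ∫ u₀ᵀ u_j`, where `u_j = u(j τ)`. -/
def dataMatrix {d m : ℕ} (Ω : Set (Space d)) (c : Space d → ℝ) (f : ℝ → ℝ)
    (xs : Fin m → Space d) (τ : ℝ) (j : ℕ) : Matrix (Fin m) (Fin m) ℝ :=
  Matrix.of fun r s =>
    ∫ x in Ω, initialState Ω c f xs r x * wave Ω c f xs (j * τ) s x

/-- The row vector field `U = (u_0, …, u_{n-1})` of snapshots `u_j^{(s)} = u^{(s)}(j τ)`. Its `n m`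
components are indexed by pairs `(j, s)`. -/
def snapshots {d m : ℕ} (Ω : Set (Space d)) (c : Space d → ℝ) (f : ℝ → ℝ)
    (xs : Fin m → Space d) (τ : ℝ) (n : ℕ) (p : Fin n × Fin m) : L2 Ω :=
  wave Ω c f xs ((p.1 : ℕ) * τ) p.2

/-- The space spanned by the components of `U`. -/
def snapshotSpace {d m : ℕ} (Ω : Set (Space d)) (c : Space d → ℝ) (f : ℝ → ℝ)
    (xs : Fin m → Space d) (τ : ℝ) (n : ℕ) : Submodule ℝ (L2 Ω) :=
  Submodule.span ℝ (Set.range (snapshots Ω c f xs τ n))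

/-! ### Galerkin approximation of the time stepping -/

/-- The product `F B` of a row vector field `F` and a matrix `B`. -/
def rowMul {d : ℕ} {Ω : Set (Space d)} {ι κ : Type*} [Fintype ι] (F : ι → L2 Ω)
    (B : Matrix ι κ ℝ) (k : κ) : L2 Ω :=
  ∑ i, B i k • F i

/-- The mass matrix `M = ∫ Uᵀ U`. -/
def massMatrix {d m : ℕ} (Ω : Set (Space d)) (c : Space d → ℝ) (f : ℝ → ℝ)
    (xs : Fin m → Space d) (τ : ℝ) (n : ℕ) : Matrix (Fin n × Fin m) (Fin n × Fin m) ℝ :=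
  Matrix.of fun p q => ∫ x in Ω, snapshots Ω c f xs τ n p x * snapshots Ω c f xs τ n q x

/-- The stiffness matrix `S = ∫ Uᵀ P U`. -/
def stiffnessMatrix {d m : ℕ} (Ω : Set (Space d)) (c : Space d → ℝ) (f : ℝ → ℝ)
    (xs : Fin m → Space d) (τ : ℝ) (n : ℕ) : Matrix (Fin n × Fin m) (Fin n × Fin m) ℝ :=
  Matrix.of fun p q =>
    ∫ x in Ω, snapshots Ω c f xs τ n p x * propagator Ω c τ (snapshots Ω c f xs τ n q) x

/-- The `(i, j)` block, of size `m × m`. -/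
def block {n m : ℕ} (B : Matrix (Fin n × Fin m) (Fin n × Fin m) ℝ) (i j : Fin n) :
    Matrix (Fin m) (Fin m) ℝ :=
  Matrix.of fun r s => B (i, r) (j, s)

/-- The block column `e_j`, of size `n m × m`, of the identity matrix. -/
def blockCol {n m : ℕ} (j : Fin n) : Matrix (Fin n × Fin m) (Fin m) ℝ :=
  Matrix.of fun p s => (1 : Matrix (Fin n × Fin m) (Fin n × Fin m) ℝ) p (j, s)

/-- `g_j` are coefficients of the Galerkin approximation `U g_j` of the time stepping
`u_{j+1} = 2 P u_j - u_{|j-1|}`: the approximation is exact at the initial time, and for every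
`j ≥ 0` the components of the residual `U g_{j+1} + U g_{|j-1|} - 2 P U g_j` are orthogonal to the
span of the components of `U`. -/
def IsGalerkin {d m : ℕ} (Ω : Set (Space d)) (c : Space d → ℝ) (f : ℝ → ℝ)
    (xs : Fin m → Space d) (τ : ℝ) (n : ℕ) (g : ℕ → Matrix (Fin n × Fin m) (Fin m) ℝ) : Prop :=
  rowMul (snapshots Ω c f xs τ n) (g 0) = initialState Ω c f xs ∧
  ∀ j : ℕ, ∀ s : Fin m, ∀ v ∈ snapshotSpace Ω c f xs τ n,
    ∫ x in Ω, v x *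
      (rowMul (snapshots Ω c f xs τ n) (g (j + 1)) s
        + rowMul (snapshots Ω c f xs τ n) (g ((j : ℤ) - 1).natAbs) s
        - (2 : ℝ) • rowMul (fun p => propagator Ω c τ (snapshots Ω c f xs τ n p)) (g j) s :
          L2 Ω) x = 0

/-! ### Block Gram-Schmidt orthogonalization and block Cholesky factorization -/

/-- `U = V R` is a block Gram-Schmidt orthogonalization of the components of `U`: the components of
`V` are orthonormal, `v_j` has components in the span of those of `u_0, …, u_j`, and `R` is
invertible and block upper triangular. -/
structure IsGramSchmidt {d n m : ℕ} {Ω : Set (Space d)} (U V : Fin n × Fin m → L2 Ω)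
    (R : Matrix (Fin n × Fin m) (Fin n × Fin m) ℝ) : Prop where
  orthonormal : ∀ p q, ∫ x in Ω, V p x * V q x =
    (1 : Matrix (Fin n × Fin m) (Fin n × Fin m) ℝ) p q
  causal : ∀ p, V p ∈ Submodule.span ℝ (U '' {q | q.1 ≤ p.1})
  factor : rowMul V R = U
  invertible : IsUnit R
  blockUpper : ∀ i j : Fin n, j < i → block R i j = 0

/-- `R` is a block Cholesky factor of `B`: it is block upper triangular and `Rᵀ R = B`. -/
def IsBlockCholesky {n m : ℕ} (R B : Matrix (Fin n × Fin m) (Fin n × Fin m) ℝ) : Prop :=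
  (∀ i j : Fin n, j < i → block R i j = 0) ∧ Rᵀ * R = B

end WaveROM

end

open WaveROM

open MeasureTheory Filter Topology
open scoped Matrix ContDiff

/-! Everything rests on the identity 2 cos a cos b = cos (a + b) + cos (a - b), carried over to
operators. The weak form of `A` is symmetric, so its eigenspaces are mutually orthogonal. By
Bessel's inequality, bounded symbols then define self-adjoint operators whose products and sums
follow those of the symbols. It is never needed that the eigenspaces span `L²(Ω)`: `u₀` is a sum of
elements of eigenspaces, so cos 0 fixes it (`cosOp_zero_funcCalcDelta`).

Self-adjointness and `two_smul_cosOp_cosOp` express `M` and `S` by data. The Galerkin conditions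
amount to `M (g_{j+1} + g_{|j-1|}) = 2 S g_j` with `g_0 = e_0` (`isGalerkin_iff`). As a Gram matrix
of independent vectors, `M` is invertible, so the recursion has one solution. The snapshots obey the
exact time stepping, so the `e_j` satisfy this recursion as long as they exist.

Finally, `U = V R` with orthonormal `V` gives `Rᵀ R = M`; conversely, a block Cholesky factor `R`
yields `V = U R⁻¹`. -/

namespace WaveROM

/-! ### Functional calculus of an orthogonal family of subspaces -/

section SpectralSum

variable {E ι : Type*} [NormedAddCommGroup E] [InnerProductSpace ℝ E]
  (W : ι → Submodule ℝ E) [∀ i, (W i).HasOrthogonalProjection]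

/-- The operator acting as multiplication by `Φ i` on the subspace `W i`. -/
noncomputable def spectralSum (Φ : ι → ℝ) (u : E) : E :=
  ∑' i, Φ i • (W i).starProjection u

variable {W}

/-- Bessel's inequality: the partial sum `S` of projections satisfies `‖S‖² = ⟨S, u⟩ ≤ ‖S‖ ‖u‖`. -/
theorem sum_norm_sq_orthogonalProjection_le
    (hW : OrthogonalFamily ℝ (fun i => W i) fun i => (W i).subtypeₗᵢ)
    (u : E) (s : Finset ι) :
    ∑ i ∈ s, ‖(W i).orthogonalProjectionOnto u‖ ^ 2 ≤ ‖u‖ ^ 2 := by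
  set S := ∑ i ∈ s, (W i).starProjection u with hS
  have h1 : ‖S‖ ^ 2 = ∑ i ∈ s, ‖(W i).orthogonalProjectionOnto u‖ ^ 2 :=
    hW.norm_sum (fun i => (W i).orthogonalProjectionOnto u) s
  have h2 : inner ℝ S u = ∑ i ∈ s, ‖(W i).orthogonalProjectionOnto u‖ ^ 2 := by
    rw [hS, sum_inner]
    refine Finset.sum_congr rfl fun i _ => ?_
    have h3 : inner ℝ ((W i).starProjection u) u
        = inner ℝ ((W i).starProjection u) ((W i).starProjection u) := by
      rw [Submodule.inner_starProjection_left_eq_right, Submodule.inner_starProjection_left_eq_right,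
        Submodule.starProjection_eq_self_iff.2 (Submodule.starProjection_apply_mem _ _)]
    rw [h3, real_inner_self_eq_norm_sq]
    rfl
  have h3 : ‖S‖ ^ 2 ≤ ‖S‖ * ‖u‖ := by
    rw [h1, ← h2]
    exact real_inner_le_norm S u
  rw [← h1]
  nlinarith [norm_nonneg S, norm_nonneg u, sq_nonneg (‖S‖ - ‖u‖)]

theorem summable_spectralSum [CompleteSpace E]
    (hW : OrthogonalFamily ℝ (fun i => W i) fun i => (W i).subtypeₗᵢ)
    {Φ : ι → ℝ} {C : ℝ} (hΦ : ∀ i, |Φ i| ≤ C) (u : E) :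
    Summable fun i => Φ i • (W i).starProjection u := by
  refine (hW.summable_iff_norm_sq_summable fun i => Φ i • (W i).orthogonalProjectionOnto u).2 ?_
  have h : Summable fun i => ‖(W i).orthogonalProjectionOnto u‖ ^ 2 :=
    summable_of_sum_le (fun i => sq_nonneg _) (sum_norm_sq_orthogonalProjection_le hW u)
  refine (h.mul_left (C ^ 2)).of_nonneg_of_le (fun i => sq_nonneg _) fun i => ?_
  rw [norm_smul, mul_pow, Real.norm_eq_abs]
  gcongr
  exact hΦ i

theorem starProjection_of_mem_ne
    (hW : OrthogonalFamily ℝ (fun i => W i) fun i => (W i).subtypeₗᵢ)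
    {i j : ι} (hij : i ≠ j) {w : E} (hw : w ∈ W i) :
    (W j).starProjection w = 0 := by
  rw [Submodule.starProjection_apply_eq_zero_iff]
  intro v hv
  exact hW hij.symm ⟨v, hv⟩ ⟨w, hw⟩

theorem starProjection_tsum_mem
    (hW : OrthogonalFamily ℝ (fun i => W i) fun i => (W i).subtypeₗᵢ)
    {w : ι → E} (hw : ∀ i, w i ∈ W i) (hs : Summable w) (j : ι) :
    (W j).starProjection (∑' i, w i) = w j := by
  rw [ContinuousLinearMap.map_tsum _ hs, tsum_eq_single j]
  · exact Submodule.starProjection_eq_self_iff.2 (hw j)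
  · intro i hij
    exact starProjection_of_mem_ne hW hij (hw i)

/-- The symbol 1 acts as the identity on such sums even if the `W i` do not span a dense subspace. A
divergent series has the default value 0, which is also fixed, so convergence of the series for `u₀`
need not be established. -/
theorem spectralSum_one_tsum_mem
    (hW : OrthogonalFamily ℝ (fun i => W i) fun i => (W i).subtypeₗᵢ)
    {w : ι → E} (hw : ∀ i, w i ∈ W i) :
    spectralSum W (fun _ => 1) (∑' i, w i) = ∑' i, w i := by
  by_cases hs : Summable w
  · simp only [spectralSum, starProjection_tsum_mem hW hw hs, one_smul]
  · simp [spectralSum, tsum_eq_zero_of_not_summable hs]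

variable [CompleteSpace E]

/-- Only the inner symbol has to be bounded: projecting the inner series term by term requires its
convergence, after which the two outer series agree termwise. -/
theorem spectralSum_spectralSum
    (hW : OrthogonalFamily ℝ (fun i => W i) fun i => (W i).subtypeₗᵢ)
    (Φ : ι → ℝ) {Ψ : ι → ℝ} {C : ℝ} (hΨ : ∀ i, |Ψ i| ≤ C) (u : E) :
    spectralSum W Φ (spectralSum W Ψ u) = spectralSum W (fun i => Φ i * Ψ i) u := by
  have h (j : ι) : (W j).starProjection (spectralSum W Ψ u) = Ψ j • (W j).starProjection u :=
    starProjection_tsum_mem hW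
      (fun i => (W i).smul_mem _ (Submodule.starProjection_apply_mem _ _))
      (summable_spectralSum hW hΨ u) j
  rw [spectralSum]
  simp only [h, smul_smul]
  rfl

theorem spectralSum_add
    (hW : OrthogonalFamily ℝ (fun i => W i) fun i => (W i).subtypeₗᵢ)
    {Φ Ψ : ι → ℝ} {C D : ℝ} (hΦ : ∀ i, |Φ i| ≤ C) (hΨ : ∀ i, |Ψ i| ≤ D)
    (u : E) :
    spectralSum W Φ u + spectralSum W Ψ u = spectralSum W (fun i => Φ i + Ψ i) u := by
  simp only [spectralSum, add_smul]
  exact ((summable_spectralSum hW hΦ u).tsum_add (summable_spectralSum hW hΨ u)).symm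

theorem inner_spectralSum
    (hW : OrthogonalFamily ℝ (fun i => W i) fun i => (W i).subtypeₗᵢ)
    {Φ : ι → ℝ} {C : ℝ} (hΦ : ∀ i, |Φ i| ≤ C) (u v : E) :
    inner ℝ u (spectralSum W Φ v) = ∑' i, Φ i * inner ℝ u ((W i).starProjection v) := by
  have h := (innerSL ℝ u).map_tsum (summable_spectralSum hW hΦ v)
  simp only [innerSL_apply_apply, inner_smul_right] at h
  exact h

theorem inner_spectralSum_left
    (hW : OrthogonalFamily ℝ (fun i => W i) fun i => (W i).subtypeₗᵢ)
    {Φ : ι → ℝ} {C : ℝ} (hΦ : ∀ i, |Φ i| ≤ C) (u v : E) :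
    inner ℝ (spectralSum W Φ u) v = inner ℝ u (spectralSum W Φ v) := by
  rw [real_inner_comm, inner_spectralSum hW hΦ, inner_spectralSum hW hΦ]
  refine tsum_congr fun i => ?_
  rw [real_inner_comm, Submodule.inner_starProjection_left_eq_right]

end SpectralSum

/-! ### Block triangular Gram factorizations -/

section Gram

variable {E : Type*} [NormedAddCommGroup E] [InnerProductSpace ℝ E]

theorem exists_orthonormal_blockTriangular {n m : ℕ} {U : Fin n × Fin m → E}
    (hU : LinearIndependent ℝ U) :
    ∃ (V : Fin n × Fin m → E) (R : Matrix (Fin n × Fin m) (Fin n × Fin m) ℝ),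
      Orthonormal ℝ V ∧ R.BlockTriangular Prod.fst ∧ ∀ q, U q = ∑ p, R p q • V p := by
  -- Scalar Gram-Schmidt in the lexicographic order: a smaller block index means a smaller pair, so
  -- the triangular factor is in particular block triangular.
  let : LocallyFiniteOrderBot (Fin n ×ₗ Fin m) :=
    LocallyFiniteOrderBot.ofIic _ (fun a => {b | b ≤ a}) (by simp)
  let U' : Fin n ×ₗ Fin m → E := fun p => U (ofLex p)
  have hU' : LinearIndependent ℝ U' := hU.comp ofLex ofLex.injective
  let V' := InnerProductSpace.gramSchmidtNormed ℝ U'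
  have hV' : Orthonormal ℝ V' := InnerProductSpace.gramSchmidtNormed_orthonormal hU'
  have hV : Orthonormal ℝ fun p => V' (toLex p) := hV'.comp toLex toLex.injective
  refine ⟨fun p => V' (toLex p), Matrix.of fun p q => inner ℝ (V' (toLex p)) (U q), hV, ?_, ?_⟩
  · intro p q hpq
    have hlt : toLex q < toLex p := Prod.Lex.toLex_lt_toLex.2 (Or.inl hpq)
    have h0 := InnerProductSpace.gramSchmidt_inv_triangular ℝ U' hlt
    simp only [Matrix.of_apply, V', InnerProductSpace.gramSchmidtNormed, inner_smul_left]
    rw [show U q = U' (toLex q) from rfl, h0, mul_zero]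
  · intro q
    have hmem : U q ∈ Submodule.span ℝ (Set.range fun p => V' (toLex p)) := by
      have hr : (Set.range fun p => V' (toLex p)) = Set.range V' :=
        toLex.surjective.range_comp V'
      rw [hr, InnerProductSpace.span_gramSchmidtNormed_range, InnerProductSpace.span_gramSchmidt]
      exact Submodule.subset_span ⟨toLex q, rfl⟩
    obtain ⟨a, ha⟩ := (Submodule.mem_span_range_iff_exists_fun ℝ).1 hmem
    rw [← ha]
    refine Finset.sum_congr rfl fun p _ => ?_
    rw [Matrix.of_apply, ← ha, hV.inner_right_fintype]

end Gram

theorem blockTriangular_iff_block {n m : ℕ} {R : Matrix (Fin n × Fin m) (Fin n × Fin m) ℝ} :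
    R.BlockTriangular Prod.fst ↔ ∀ i j : Fin n, j < i → block R i j = 0 := by
  constructor
  · intro h i j hij
    ext r s
    exact h hij
  · rintro h ⟨i, r⟩ ⟨j, s⟩ hij
    exact congrFun (congrFun (h i j hij) r) s

/-! ### Row vectors of elements of `L²(Ω)` -/

section RowMul

variable {d : ℕ} {Ω : Set (Space d)} {ι κ μ : Type*} [Fintype ι]

theorem integral_mul_eq_inner (u v : L2 Ω) : ∫ x in Ω, u x * v x = inner ℝ u v := by
  rw [L2.inner_def]
  refine integral_congr_ae (Eventually.of_forall fun x => ?_)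
  simp [mul_comm]

theorem rowMul_rowMul [Fintype κ] (F : ι → L2 Ω) (A : Matrix ι κ ℝ) (B : Matrix κ μ ℝ) :
    rowMul (rowMul F A) B = rowMul F (A * B) := by
  funext k
  simp only [rowMul, Matrix.mul_apply, Finset.smul_sum, Finset.sum_smul, smul_smul]
  rw [Finset.sum_comm]
  simp only [mul_comm]

theorem rowMul_one [DecidableEq ι] (F : ι → L2 Ω) : rowMul F (1 : Matrix ι ι ℝ) = F := by
  funext k
  simp [rowMul, Matrix.one_apply]

theorem inner_rowMul (u : L2 Ω) (F : ι → L2 Ω) (B : Matrix ι κ ℝ) (k : κ) :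
    inner ℝ u (rowMul F B k) = ∑ i, inner ℝ u (F i) * B i k := by
  simp only [rowMul, inner_sum, inner_smul_right, mul_comm]

theorem gram_rowMul (F : ι → L2 Ω) (B : Matrix ι κ ℝ) :
    Matrix.gram ℝ (rowMul F B) = Bᵀ * Matrix.gram ℝ F * B := by
  ext k l
  rw [Matrix.gram_apply, inner_rowMul, Matrix.mul_apply]
  refine Finset.sum_congr rfl fun i _ => ?_
  rw [real_inner_comm, inner_rowMul, Matrix.mul_apply]
  simp only [Matrix.transpose_apply, Matrix.gram_apply]
  congr 1
  refine Finset.sum_congr rfl fun j _ => ?_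
  rw [mul_comm, real_inner_comm]

theorem rowMul_injective {F : ι → L2 Ω} (hF : LinearIndependent ℝ F) :
    Function.Injective fun B : Matrix ι κ ℝ => rowMul F B := by
  intro A B h
  ext i k
  have hk : ∑ i, A i k • F i = ∑ i, B i k • F i := congrFun h k
  exact congrFun (hF.fintypeLinearCombination_injective (a₁ := fun i => A i k)
    (a₂ := fun i => B i k) hk) i

omit [Fintype ι] in
theorem gram_eq_one_iff_orthonormal [DecidableEq ι] (V : ι → L2 Ω) :
    Matrix.gram ℝ V = 1 ↔ Orthonormal ℝ V := by
  rw [orthonormal_iff_ite]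
  simp [← Matrix.ext_iff, Matrix.one_apply]

omit [Fintype ι] in
theorem forall_mem_span_integral_mul_eq_zero_iff (F : ι → L2 Ω) (w : L2 Ω) :
    (∀ v ∈ Submodule.span ℝ (Set.range F), ∫ x in Ω, v x * w x = 0) ↔
      ∀ p, inner ℝ (F p) w = 0 := by
  simp only [integral_mul_eq_inner]
  constructor
  · intro h p
    exact h _ (Submodule.subset_span ⟨p, rfl⟩)
  · intro h v hv
    induction hv using Submodule.span_induction with
    | mem x hx => obtain ⟨p, rfl⟩ := hx; exact h p
    | zero => exact inner_zero_left _
    | add x y _ _ hx hy => rw [inner_add_left, hx, hy, add_zero]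
    | smul a x _ hx => rw [inner_smul_left, hx, mul_zero]

end RowMul

/-! ### Gram-Schmidt factors are the block Cholesky factors of the Gram matrix -/

section GramSchmidt

variable {d n m : ℕ} {Ω : Set (Space d)} {U V : Fin n × Fin m → L2 Ω}
  {R : Matrix (Fin n × Fin m) (Fin n × Fin m) ℝ}

theorem IsGramSchmidt.transpose_mul_self (h : IsGramSchmidt U V R) :
    Rᵀ * R = Matrix.gram ℝ U := by
  have hV : Matrix.gram ℝ V = 1 := by
    ext p q
    rw [Matrix.gram_apply, ← integral_mul_eq_inner, h.orthonormal]
  rw [← h.factor, gram_rowMul, hV, Matrix.mul_one]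

theorem IsBlockCholesky.isUnit (hU : LinearIndependent ℝ U)
    (h : IsBlockCholesky R (Matrix.gram ℝ U)) : IsUnit R := by
  have hpos := (Matrix.posDef_gram_of_linearIndependent hU).isUnit
  rw [← h.2] at hpos
  rw [Matrix.isUnit_iff_isUnit_det] at hpos ⊢
  rw [Matrix.det_mul] at hpos
  exact isUnit_of_mul_isUnit_right hpos

/-- The Gram matrix of `U R⁻¹` is `R⁻ᵀ (Rᵀ R) R⁻¹ = 1`, and causality holds because the inverse of a
block triangular matrix is block triangular. -/
theorem IsBlockCholesky.isGramSchmidt (hU : LinearIndependent ℝ U)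
    (h : IsBlockCholesky R (Matrix.gram ℝ U)) : IsGramSchmidt U (rowMul U R⁻¹) R := by
  have hR := h.isUnit hU
  have hdet := (Matrix.isUnit_iff_isUnit_det R).1 hR
  have htri := blockTriangular_iff_block.2 h.1
  have hinv : R⁻¹.BlockTriangular Prod.fst := by
    let := hR.invertible
    exact Matrix.blockTriangular_inv_of_blockTriangular htri
  refine ⟨fun p q => ?_, fun p => ?_, ?_, hR, h.1⟩
  · rw [integral_mul_eq_inner, ← Matrix.gram_apply, gram_rowMul, ← h.2, ← Matrix.mul_assoc,
      Matrix.mul_assoc, Matrix.mul_nonsing_inv _ hdet, Matrix.mul_one, ← Matrix.transpose_mul,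
      Matrix.mul_nonsing_inv _ hdet, Matrix.transpose_one]
  · refine Submodule.sum_mem _ fun q _ => ?_
    rcases le_or_gt q.1 p.1 with hq | hq
    · exact Submodule.smul_mem _ _ (Submodule.subset_span ⟨q, hq, rfl⟩)
    · rw [hinv hq, zero_smul]
      exact Submodule.zero_mem _
  · rw [rowMul_rowMul, Matrix.nonsing_inv_mul _ hdet, rowMul_one]

theorem exists_isGramSchmidt (hU : LinearIndependent ℝ U) :
    ∃ V R, IsGramSchmidt U V R := by
  obtain ⟨V, R, hV, hR, hUVR⟩ := exists_orthonormal_blockTriangular hU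
  have hfac : rowMul V R = U := funext fun q => (hUVR q).symm
  -- Only `R` is kept from the scalar construction; causality and invertibility then follow from the
  -- Cholesky property.
  refine ⟨_, R, IsBlockCholesky.isGramSchmidt hU ⟨blockTriangular_iff_block.1 hR, ?_⟩⟩
  rw [← hfac, gram_rowMul, (gram_eq_one_iff_orthonormal V).2 hV, Matrix.mul_one]

theorem exists_isGramSchmidt_iff_isBlockCholesky (hU : LinearIndependent ℝ U) :
    (∃ V, IsGramSchmidt U V R) ↔ IsBlockCholesky R (Matrix.gram ℝ U) := by
  constructor
  · rintro ⟨V, h⟩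
    exact ⟨h.blockUpper, h.transpose_mul_self⟩
  · intro h
    exact ⟨_, h.isGramSchmidt hU⟩

end GramSchmidt

/-! ### Three term recursions -/

/-- The recursion `M (g_{j+1} + g_{|j-1|}) = 2 S g_j` with invertible `M` has exactly one solution
with a given initial term. -/
theorem existsUnique_recursion {ι κ : Type*} [Fintype ι] [DecidableEq ι] {M S : Matrix ι ι ℝ}
    (hM : IsUnit M) (a : Matrix ι κ ℝ) :
    ∃! g : ℕ → Matrix ι κ ℝ, g 0 = a ∧
      ∀ j : ℕ, M * (g (j + 1) + g ((j : ℤ) - 1).natAbs) = (2 : ℝ) • (S * g j) := by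
  have hdet := (Matrix.isUnit_iff_isUnit_det M).1 hM
  -- The state is the pair `(g_j, g_{j+1})`. At `j = 0` the index `|j-1|` is 1, so the equation
  -- reads `2 M g_1 = 2 S a`, hence `g_1 = M⁻¹ S a`.
  let h : ℕ → Matrix ι κ ℝ × Matrix ι κ ℝ := fun j =>
    Nat.rec (a, M⁻¹ * (S * a)) (fun _ p => (p.2, M⁻¹ * ((2 : ℝ) • (S * p.2)) - p.1)) j
  have natAbs_succ (k : ℕ) : (((k + 1 : ℕ) : ℤ) - 1).natAbs = k := by omega
  refine ⟨fun j => (h j).1, ⟨rfl, fun j => ?_⟩, ?_⟩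
  · cases j with
    | zero =>
      change M * (M⁻¹ * (S * a) + M⁻¹ * (S * a)) = (2 : ℝ) • (S * a)
      rw [← Matrix.mul_add, ← Matrix.mul_assoc, Matrix.mul_nonsing_inv _ hdet, Matrix.one_mul,
        two_smul]
    | succ k =>
      simp only [natAbs_succ]
      change M * (M⁻¹ * ((2 : ℝ) • (S * (h k).2)) - (h k).1 + (h k).1) = (2 : ℝ) • (S * (h k).2)
      rw [sub_add_cancel, ← Matrix.mul_assoc, Matrix.mul_nonsing_inv _ hdet, Matrix.one_mul]
  · rintro g ⟨hg0, hg⟩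
    have hcancel {A B : Matrix ι κ ℝ} (hAB : M * A = B) : A = M⁻¹ * B := by
      rw [← hAB, ← Matrix.mul_assoc, Matrix.nonsing_inv_mul _ hdet, Matrix.one_mul]
    have key (j : ℕ) : g j = (h j).1 ∧ g (j + 1) = (h j).2 := by
      induction j with
      | zero =>
        refine ⟨hg0, ?_⟩
        have h1 := hcancel (hg 0)
        change g 1 + g 1 = _ at h1
        rw [← two_smul ℝ (g 1), Matrix.mul_smul, hg0] at h1
        exact smul_right_injective _ (two_ne_zero' ℝ) h1
      | succ k ih =>
        refine ⟨ih.2, ?_⟩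
        have h1 := hcancel (hg (k + 1))
        rw [natAbs_succ, ih.1, ih.2] at h1
        exact eq_sub_of_add_eq h1
    exact funext fun j => (key j).1

/-- Two solutions of the recursion `M (g_{j+1} + g_{|j-1|}) = 2 S g_j`, the second of which is only
known up to the index `N`, agree up to `N`. -/
theorem recursion_unique_of_le {ι κ : Type*} [Fintype ι] [DecidableEq ι] {M S : Matrix ι ι ℝ}
    (hM : IsUnit M) {g e : ℕ → Matrix ι κ ℝ} {N : ℕ} (h0 : g 0 = e 0)
    (hg : ∀ j : ℕ, M * (g (j + 1) + g ((j : ℤ) - 1).natAbs) = (2 : ℝ) • (S * g j))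
    (he : ∀ j : ℕ, j + 1 < N → M * (e (j + 1) + e ((j : ℤ) - 1).natAbs) = (2 : ℝ) • (S * e j))
    {j : ℕ} (hj : j < N) : g j = e j := by
  have hdet := (Matrix.isUnit_iff_isUnit_det M).1 hM
  induction j using Nat.strong_induction_on with
  | _ j ih =>
  cases j with
  | zero => exact h0
  | succ k =>
    have h1 := hg k
    rw [ih k (by omega) (by omega), ← he k hj] at h1
    have h2 : g (k + 1) + g ((k : ℤ) - 1).natAbs = e (k + 1) + e ((k : ℤ) - 1).natAbs := by
      have h3 := congrArg (fun X => M⁻¹ * X) h1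
      simpa only [← Matrix.mul_assoc, Matrix.nonsing_inv_mul _ hdet, Matrix.one_mul] using h3
    cases k with
    | zero =>
      change g 1 + g 1 = e 1 + e 1 at h2
      rw [← two_smul ℝ (g 1), ← two_smul ℝ (e 1)] at h2
      exact smul_right_injective _ (two_ne_zero' ℝ) h2
    | succ l =>
      have hl : (((l + 1 : ℕ) : ℤ) - 1).natAbs = l := by omega
      rw [hl, ih l (by omega) (by omega)] at h2
      exact add_right_cancel h2

/-! ### Spectral decomposition of the wave operator -/

section Operator

variable {d : ℕ} (Ω : Set (Space d)) (c : Space d → ℝ)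

variable {Ω c} in
-- Testing the equation of each eigenfunction with the other evaluates the same symmetric form as `θ
-- ⟨u, v⟩` and as `η ⟨u, v⟩`.
theorem inner_eq_zero_of_mem_waveOpGraph {θ η : ℝ} (hne : θ ≠ η) {u v : L2 Ω}
    (hu : (u, θ • u) ∈ waveOpGraph Ω c) (hv : (v, η • v) ∈ waveOpGraph Ω c) :
    inner ℝ u v = 0 := by
  obtain ⟨G, hG, hGu⟩ := hu
  obtain ⟨H, hH, hHv⟩ := hv
  have h1 : ∫ x in Ω, inner ℝ (G x) (H x) = θ * inner ℝ u v := by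
    rw [hGu _ hH, integral_mul_eq_inner, inner_smul_left]
    rfl
  have h2 : ∫ x in Ω, inner ℝ (G x) (H x) = η * inner ℝ u v := by
    simp only [real_inner_comm (H _) (G _)]
    rw [hHv _ hG, integral_mul_eq_inner, inner_smul_left, real_inner_comm]
    rfl
  have h3 : (θ - η) * inner ℝ u v = 0 := by rw [sub_mul, ← h1, ← h2, sub_self]
  exact (mul_eq_zero.1 h3).resolve_left (sub_ne_zero.2 hne)

theorem orthogonalFamily_eigenspace :
    OrthogonalFamily ℝ (fun θ => eigenspace Ω c θ) fun θ => (eigenspace Ω c θ).subtypeₗᵢ := by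
  refine OrthogonalFamily.of_pairwise fun θ η hne => ?_
  have hspan : Submodule.span ℝ {u : L2 Ω | (u, θ • u) ∈ waveOpGraph Ω c} ⟂
      Submodule.span ℝ {u : L2 Ω | (u, η • u) ∈ waveOpGraph Ω c} := by
    rw [Submodule.isOrtho_span]
    intro u hu v hv
    exact inner_eq_zero_of_mem_waveOpGraph hne hu hv
  -- Orthogonal complements are closed, so orthogonality passes to the closures, one side at a time.
  have hl : eigenspace Ω c θ ⟂ Submodule.span ℝ {u : L2 Ω | (u, η • u) ∈ waveOpGraph Ω c} :=
    Submodule.topologicalClosure_minimal _ hspan (Submodule.isClosed_orthogonal _)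
  have hr : eigenspace Ω c η ⟂ eigenspace Ω c θ :=
    Submodule.topologicalClosure_minimal _ hl.symm (Submodule.isClosed_orthogonal _)
  exact hr.symm

theorem spectralKernel_mem (θ : ℝ) (x : Space d) : spectralKernel Ω c θ x ∈ eigenspace Ω c θ := by
  unfold spectralKernel
  split_ifs with h
  · exact h.choose_spec.1
  · exact Submodule.zero_mem _

theorem abs_cos_mul_sqrt_le (t θ : ℝ) : |Real.cos (t * Real.sqrt θ)| ≤ 1 :=
  Real.abs_cos_le_one _

/-- The operator `cos(t √A)`. -/
noncomputable def cosOp (t : ℝ) (u : L2 Ω) : L2 Ω :=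
  funcCalc Ω c (fun θ => Real.cos (t * Real.sqrt θ)) u

theorem inner_cosOp_left (t : ℝ) (u v : L2 Ω) :
    inner ℝ (cosOp Ω c t u) v = inner ℝ u (cosOp Ω c t v) :=
  inner_spectralSum_left (orthogonalFamily_eigenspace Ω c) (abs_cos_mul_sqrt_le t) u v

theorem two_smul_cosOp_cosOp (s t : ℝ) (u : L2 Ω) :
    (2 : ℝ) • cosOp Ω c s (cosOp Ω c t u) = cosOp Ω c (s + t) u + cosOp Ω c (s - t) u := by
  have hW := orthogonalFamily_eigenspace Ω c
  have h1 : cosOp Ω c s (cosOp Ω c t u) = _ :=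
    spectralSum_spectralSum hW _ (abs_cos_mul_sqrt_le t) u
  have h2 : cosOp Ω c (s + t) u + cosOp Ω c (s - t) u = _ :=
    spectralSum_add hW (abs_cos_mul_sqrt_le (s + t)) (abs_cos_mul_sqrt_le (s - t)) u
  rw [h1, h2, spectralSum, spectralSum, ← tsum_const_smul'']
  refine tsum_congr fun θ => ?_
  rw [smul_smul, add_mul, sub_mul, Real.cos_add, Real.cos_sub]
  ring_nf

theorem cosOp_abs (t : ℝ) (u : L2 Ω) : cosOp Ω c |t| u = cosOp Ω c t u := by
  rcases abs_choice t with h | h <;> simp [h, cosOp]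

theorem cosOp_zero_funcCalcDelta (Φ : ℝ → ℝ) (x : Space d) :
    cosOp Ω c 0 (funcCalcDelta Ω c Φ x) = funcCalcDelta Ω c Φ x := by
  simp only [cosOp, zero_mul, Real.cos_zero]
  exact spectralSum_one_tsum_mem (orthogonalFamily_eigenspace Ω c)
    fun θ => Submodule.smul_mem _ _ (spectralKernel_mem Ω c θ x)

end Operator

/-! ### Snapshots and data -/

section Snapshots

variable {d m : ℕ} (Ω : Set (Space d)) (c : Space d → ℝ) (f : ℝ → ℝ)
  (xs : Fin m → Space d) (τ : ℝ) (n : ℕ)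

theorem snapshots_eq (p : Fin n × Fin m) :
    snapshots Ω c f xs τ n p = cosOp Ω c ((p.1 : ℕ) * τ) (initialState Ω c f xs p.2) := rfl

theorem massMatrix_eq_gram :
    massMatrix Ω c f xs τ n = Matrix.gram ℝ (snapshots Ω c f xs τ n) := by
  ext p q
  exact integral_mul_eq_inner _ _

theorem stiffnessMatrix_apply (p q : Fin n × Fin m) :
    stiffnessMatrix Ω c f xs τ n p q =
      inner ℝ (snapshots Ω c f xs τ n p) (cosOp Ω c τ (snapshots Ω c f xs τ n q)) :=
  integral_mul_eq_inner _ _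

/-- Evenness of the cosine lets the indices `|i - j|` be treated as signed integers. -/
theorem cosOp_natAbs_mul (k : ℤ) (u : L2 Ω) :
    cosOp Ω c ((k.natAbs : ℕ) * τ) u = cosOp Ω c (k * τ) u := by
  rcases Int.natAbs_eq k with h | h
  · conv_rhs => rw [h]
    simp
  · conv_rhs => rw [h]
    rw [← cosOp_abs Ω c ((k.natAbs : ℕ) * τ), ← cosOp_abs Ω c (((-(k.natAbs : ℤ) : ℤ) : ℝ) * τ)]
    simp

theorem dataMatrix_natAbs_apply (k : ℤ) (r s : Fin m) :
    dataMatrix Ω c f xs τ k.natAbs r s =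
      inner ℝ (initialState Ω c f xs r) (cosOp Ω c (k * τ) (initialState Ω c f xs s)) := by
  rw [← cosOp_natAbs_mul]
  exact integral_mul_eq_inner _ _

theorem dataMatrix_apply (k : ℕ) (r s : Fin m) :
    dataMatrix Ω c f xs τ k r s =
      inner ℝ (initialState Ω c f xs r) (cosOp Ω c (k * τ) (initialState Ω c f xs s)) :=
  integral_mul_eq_inner _ _

theorem block_massMatrix (i j : Fin n) :
    block (massMatrix Ω c f xs τ n) i j =
      (1 / 2 : ℝ) • (dataMatrix Ω c f xs τ (i + j)
        + dataMatrix Ω c f xs τ ((i : ℤ) - j).natAbs) := by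
  ext r s
  simp only [block, massMatrix_eq_gram, Matrix.of_apply, Matrix.gram_apply, Matrix.smul_apply,
    Matrix.add_apply, dataMatrix_natAbs_apply, snapshots_eq, inner_cosOp_left,
    smul_eq_mul]
  simp only [dataMatrix_apply]
  rw [← inner_add_right]
  push_cast
  rw [add_mul, sub_mul, ← two_smul_cosOp_cosOp, inner_smul_right]
  ring

theorem block_stiffnessMatrix (i j : Fin n) :
    block (stiffnessMatrix Ω c f xs τ n) i j =
      (1 / 4 : ℝ) • (dataMatrix Ω c f xs τ (i + j + 1)
        + dataMatrix Ω c f xs τ ((i : ℤ) - j + 1).natAbs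
        + dataMatrix Ω c f xs τ ((i : ℤ) + j - 1).natAbs
        + dataMatrix Ω c f xs τ ((i : ℤ) - j - 1).natAbs) := by
  ext r s
  simp only [block, Matrix.of_apply, stiffnessMatrix_apply, Matrix.smul_apply,
    Matrix.add_apply, dataMatrix_natAbs_apply, snapshots_eq, inner_cosOp_left,
    smul_eq_mul]
  simp only [dataMatrix_apply]
  set u := initialState Ω c f xs r
  set v := initialState Ω c f xs s
  -- The product formula is applied first to `iτ` and `τ`, then to `(i ± 1)τ` and `jτ`: this gives
  -- four terms and the factor 1/4.
  have h1 : (2 : ℝ) * inner ℝ u (cosOp Ω c ((i : ℕ) * τ) (cosOp Ω c τ (cosOp Ω c ((j : ℕ) * τ) v)))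
      = inner ℝ u (cosOp Ω c (((i : ℕ) + 1) * τ) (cosOp Ω c ((j : ℕ) * τ) v))
        + inner ℝ u (cosOp Ω c (((i : ℕ) - 1) * τ) (cosOp Ω c ((j : ℕ) * τ) v)) := by
    rw [← inner_smul_right, two_smul_cosOp_cosOp, inner_add_right, add_mul, sub_mul, one_mul]
  have h2 (a b : ℝ) : (2 : ℝ) * inner ℝ u (cosOp Ω c (a * τ) (cosOp Ω c (b * τ) v))
      = inner ℝ u (cosOp Ω c ((a + b) * τ) v) + inner ℝ u (cosOp Ω c ((a - b) * τ) v) := by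
    rw [← inner_smul_right, two_smul_cosOp_cosOp, inner_add_right, add_mul, sub_mul]
  have h3 := h2 ((i : ℕ) + 1) (j : ℕ)
  have h4 := h2 ((i : ℕ) - 1) (j : ℕ)
  push_cast
  rw [show ((i : ℕ) : ℝ) + (j : ℕ) + 1 = (i : ℕ) + 1 + (j : ℕ) by ring,
    show ((i : ℕ) : ℝ) - (j : ℕ) + 1 = (i : ℕ) + 1 - (j : ℕ) by ring,
    show ((i : ℕ) : ℝ) + (j : ℕ) - 1 = (i : ℕ) - 1 + (j : ℕ) by ring,
    show ((i : ℕ) : ℝ) - (j : ℕ) - 1 = (i : ℕ) - 1 - (j : ℕ) by ring]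
  linarith

variable {Ω c f xs τ n} in
theorem linearIndependent_snapshots
    (hdim : Module.finrank ℝ (snapshotSpace Ω c f xs τ n) = n * m) :
    LinearIndependent ℝ (snapshots Ω c f xs τ n) := by
  rw [linearIndependent_iff_card_eq_finrank_span]
  rw [Fintype.card_prod, Fintype.card_fin, Fintype.card_fin]
  exact hdim.symm

/-- The block columns of the identity, continued by zero. -/
noncomputable def blockColNat (j : ℕ) : Matrix (Fin n × Fin m) (Fin m) ℝ :=
  if h : j < n then blockCol ⟨j, h⟩ else 0

variable {n} in
theorem mul_blockCol {ι : Type*} (B : Matrix ι (Fin n × Fin m) ℝ) (j : Fin n) :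
    B * (blockCol j : Matrix (Fin n × Fin m) (Fin m) ℝ) = Matrix.of fun p s => B p (j, s) := by
  ext p s
  rw [Matrix.mul_apply]
  simp [blockCol, Matrix.one_apply]

variable {n} in
theorem rowMul_blockCol (F : Fin n × Fin m → L2 Ω) (j : Fin n) :
    rowMul F (blockCol j) = fun s => F (j, s) := by
  funext s
  simp [rowMul, blockCol, Matrix.one_apply]

/-- The snapshots satisfy the time stepping `u_{j+1} + u_{|j-1|} = 2 P u_j`. -/
theorem massMatrix_mul_blockColNat {j : ℕ} (hj : j + 1 < n) :
    massMatrix Ω c f xs τ n *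
      (blockColNat (m := m) n (j + 1) + blockColNat (m := m) n ((j : ℤ) - 1).natAbs) =
      (2 : ℝ) • (stiffnessMatrix Ω c f xs τ n * blockColNat (m := m) n j) := by
  -- At `j = 0` this index is 1, covered by `hj`.
  have h1 : ((j : ℤ) - 1).natAbs < n := by omega
  rw [blockColNat, blockColNat, blockColNat, dif_pos hj, dif_pos h1, dif_pos (by omega),
    Matrix.mul_add, mul_blockCol, mul_blockCol, mul_blockCol, massMatrix_eq_gram]
  ext p s
  simp only [Matrix.add_apply, Matrix.of_apply, Matrix.gram_apply, Matrix.smul_apply,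
    stiffnessMatrix_apply, smul_eq_mul]
  rw [← inner_add_right, ← inner_smul_right]
  simp only [snapshots_eq]
  -- The product formula produces the time `τ - jτ`, which evenness turns into `(j - 1)τ`.
  rw [two_smul_cosOp_cosOp, cosOp_natAbs_mul, ← cosOp_abs Ω c (τ - _), abs_sub_comm, cosOp_abs]
  push_cast
  rw [add_mul, sub_mul, one_mul, add_comm τ]

variable {Ω c f xs τ n} in
-- Orthogonality to the span need only be tested on the snapshots, which gives the rows of the
-- matrix equation. Independence of the snapshots turns `U g_0 = u_0 = U e_0` into `g_0 = e_0`.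
theorem isGalerkin_iff (hn : 0 < n) (hU : LinearIndependent ℝ (snapshots Ω c f xs τ n))
    (g : ℕ → Matrix (Fin n × Fin m) (Fin m) ℝ) :
    IsGalerkin Ω c f xs τ n g ↔ g 0 = blockCol ⟨0, hn⟩ ∧
      ∀ j : ℕ, massMatrix Ω c f xs τ n * (g (j + 1) + g ((j : ℤ) - 1).natAbs) =
        (2 : ℝ) • (stiffnessMatrix Ω c f xs τ n * g j) := by
  have h0 : rowMul (snapshots Ω c f xs τ n) (blockCol ⟨0, hn⟩) = initialState Ω c f xs := by
    rw [rowMul_blockCol]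
    funext s
    simp only [snapshots_eq, Nat.cast_zero, zero_mul]
    exact cosOp_zero_funcCalcDelta Ω c _ _
  refine and_congr ?_ (forall_congr' fun j => ?_)
  · rw [← h0]
    exact (rowMul_injective hU).eq_iff
  · simp only [snapshotSpace, forall_mem_span_integral_mul_eq_zero_iff]
    rw [← Matrix.ext_iff, forall_comm]
    refine forall_congr' fun p => forall_congr' fun s => ?_
    rw [inner_sub_right, inner_add_right, inner_smul_right, inner_rowMul, inner_rowMul,
      inner_rowMul, sub_eq_zero, Matrix.mul_add, Matrix.add_apply, Matrix.smul_apply,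
      Matrix.mul_apply, Matrix.mul_apply, Matrix.mul_apply, massMatrix_eq_gram]
    simp only [stiffnessMatrix_apply, Matrix.gram_apply, smul_eq_mul]
    rfl

end Snapshots

end WaveROM

open WaveROM
theorem theorem1
    {d m n : ℕ} (hn : 0 < n)
    -- the domain and the wave speed
    (Ω : Set (Space d)) (hΩ : IsOpen Ω) (hΩb : Bornology.IsBounded Ω)
    (c : Space d → ℝ) (hc : Measurable c)
    (cmin cmax : ℝ) (hcmin : 0 < cmin) (hcbd : ∀ x ∈ Ω, cmin ≤ c x ∧ c x ≤ cmax)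
    -- the array, near which the wave speed is constant
    (xs : Fin m → Space d) (hxs : ∀ s, xs s ∈ Ω)
    (cbar : ℝ) (hcbar : ∀ s, ∀ᶠ x in 𝓝 (xs s), c x = cbar)
    -- the signal and the time step
    (f : ℝ → ℝ) (hf : Integrable f) (τ : ℝ) (hτ : 0 < τ)
    -- the snapshots are linearly independent
    (hdim : Module.finrank ℝ (snapshotSpace Ω c f xs τ n) = n * m) :
    -- the Galerkin coefficients
    ((∃! g, IsGalerkin Ω c f xs τ n g) ∧
      ∀ g, IsGalerkin Ω c f xs τ n g → ∀ j : Fin n, g j = blockCol j) ∧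
    -- the mass matrix
    (∀ i j : Fin n, block (massMatrix Ω c f xs τ n) i j =
      (1 / 2 : ℝ) • (dataMatrix Ω c f xs τ (i + j)
        + dataMatrix Ω c f xs τ ((i : ℤ) - j).natAbs)) ∧
    -- the stiffness matrix
    (∀ i j : Fin n, block (stiffnessMatrix Ω c f xs τ n) i j =
      (1 / 4 : ℝ) • (dataMatrix Ω c f xs τ (i + j + 1)
        + dataMatrix Ω c f xs τ ((i : ℤ) - j + 1).natAbs
        + dataMatrix Ω c f xs τ ((i : ℤ) + j - 1).natAbs
        + dataMatrix Ω c f xs τ ((i : ℤ) - j - 1).natAbs)) ∧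
    -- the Gram-Schmidt factors are the block Cholesky factors of the mass matrix
    (∀ V R, IsGramSchmidt (snapshots Ω c f xs τ n) V R →
      Rᵀ * R = massMatrix Ω c f xs τ n) ∧
    (∀ R, (∃ V, IsGramSchmidt (snapshots Ω c f xs τ n) V R) ↔
      IsBlockCholesky R (massMatrix Ω c f xs τ n)) ∧
    (∃ V R, IsGramSchmidt (snapshots Ω c f xs τ n) V R) := by
  have hU := linearIndependent_snapshots hdim
  have hM : IsUnit (massMatrix Ω c f xs τ n) := by
    rw [massMatrix_eq_gram]
    exact (Matrix.posDef_gram_of_linearIndependent hU).isUnit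
  refine ⟨⟨?_, ?_⟩, block_massMatrix Ω c f xs τ n, block_stiffnessMatrix Ω c f xs τ n, ?_, ?_,
    exists_isGramSchmidt hU⟩
  · simp only [isGalerkin_iff hn hU]
    exact existsUnique_recursion hM _
  · intro g hg j
    obtain ⟨h0, hrec⟩ := (isGalerkin_iff hn hU g).1 hg
    -- The continuation of `e_j` by zero only makes it a sequence on `ℕ`; its recursion is used for
    -- `j + 1 < n` alone.
    have h := recursion_unique_of_le hM (e := blockColNat n) (by simp [blockColNat, hn, h0]) hrec
      (fun j hj => massMatrix_mul_blockColNat Ω c f xs τ n hj) j.isLt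
    simpa [blockColNat] using h
  · intro V R h
    rw [massMatrix_eq_gram]
    exact h.transpose_mul_self
  · intro R
    rw [massMatrix_eq_gram]
    exact exists_isGramSchmidt_iff_isBlockCholesky hU
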